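/- **Theorem (lower bound for learning decoders under output noise).** Consider the scalar system $$x_{t+1}=a x_t+b u_t+w_t,\qquad y_t=f_\star^{-1}(x_t)+\varepsilon_t ,\qquad t\in\{0,1\},$$ with horizon $T=1$, a deterministic initial state $x_0$, and independent noises $w_t,\varepsilon_t\sim\mathcal N(0,1)$. A learning algorithm $\mathsf A$ plays trajectories one after the other, choosing each control $u_t$ adaptively (and possibly at random) from everything it has observed so far, and then outputs a (measurable) decoder $\hat f_{\mathsf A}:\mathbb R\to\mathbb R$. A roll-in policy $\pi$ is a (possibly randomized) rule choosing $u_0$ from $y_0$ and $u_1$ from $(y_0,u_0,y_1)$. Write $$\mathrm{err}_{f_\star}(\mathsf A,\pi)=\mathbb E_{\mathsf A}\,\mathbb E_{\pi}\big[(\hat f_{\mathsf A}(y_1)-f_\star(y_1))^2\big]\in[0,\infty],$$ where $\hat f_{\mathsf A}$ is learned from trajectories with true decoder $f_\star$ and $y_1$ is the time-1 observation in an independent trajectory of the same system rolled in with $\pi$. (i) There are absolute constants $c,L>0$ and $n_0\in\mathbb N$ such that for every $n\ge n_0$ there exist a system $(a,b,x_0)$ with $|a|<1$ and $b\ne0$,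 and a class $\mathcal F$ of exactly two bijections $f:\mathbb R\to\mathbb R$, each $L\log^{1/2}n$-Lipschitz and differentiable with $f'(y)\ge 1$ for all $y\in\mathbb R$, such that the following holds. For every learning algorithm $\mathsf A$ that uses at most $n$ trajectories and controls with $|u_t|\le 64\log^{1/2}n$, there is $f_\star\in\mathcal F$ such that for every roll-in policy $\pi$ with $|u_t|\le 64\log^{1/2}n$, $$\mathrm{err}_{f_\star}(\mathsf A,\pi)\ \ge\ \frac{c}{\log^{3/2}n}.$$ (ii) Consequently, learning an $\varepsilon$-optimal decoder needs exponentially many samples in $\varepsilon^{-2/3}$: there are absolute constants $c,L,\varepsilon_0>0$ such that for every $0<\varepsilon<\varepsilon_0$ there exist a system with $|a|<1$, $b\neq 0$, and a class $\mathcal F$ of exactly two bijections of $\mathbb R$, each $L\varepsilon^{-1/3}$-Lipschitz and differentiable with derivative at least $1$ everywhere, such that for every algorithm $\mathsf A$ using at most $n_\varepsilon:=\exp(c\,\varepsilon^{-2/3})$ trajectories and controls with $|u_t|\le 64\log^{1/2}n_\varepsilon$ there is $f_\star\in\mathcal F$ with $\mathrm{err}_{f_\star}(\mathsf A,\pi)>\varepsilon$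 for every roll-in policy $\pi$ with $|u_t|\le 64\log^{1/2}n_\varepsilon$. -/

import Mathlib

open MeasureTheory ProbabilityTheory
open scoped ENNReal

namespace NoisyDecoding

/-- A scalar linear system `x_{t+1} = a x_t + b u_t + w_t` with deterministic initial state `x₀`. -/
structure ScalarSystem where
  a : ℝ
  b : ℝ
  x₀ : ℝ

/-- The noise variables `(w_0, ε_0, ε_1)` that act on `(y_0, y_1)` in one trajectory of
horizon `T = 1`. -/
abbrev Noise : Type := ℝ × ℝ × ℝ

/-- The observable part `(y_0, u_0, y_1, u_1)` of one trajectory of horizon `T = 1`. -/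
abbrev Record : Type := ℝ × ℝ × ℝ × ℝ

/-- `w_0, ε_0, ε_1` are independent standard Gaussians. -/
noncomputable def noiseLaw : Measure Noise :=
  (gaussianReal 0 1).prod ((gaussianReal 0 1).prod (gaussianReal 0 1))

/-- One trajectory under the true decoder `f`: the observations are `y_t = f⁻¹(x_t) + ε_t`, and
the controls are `u_0 = c₀ y_0` and `u_1 = c₁ (y_0, u_0, y_1)`. -/
def trajectory (sys : ScalarSystem) (f : ℝ ≃ ℝ) (c₀ : ℝ → ℝ) (c₁ : ℝ × ℝ × ℝ → ℝ)
    (ν : Noise) : Record :=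
  let w₀ := ν.1
  let ε₀ := ν.2.1
  let ε₁ := ν.2.2
  let y₀ := f.symm sys.x₀ + ε₀
  let u₀ := c₀ y₀
  let x₁ := sys.a * sys.x₀ + sys.b * u₀ + w₀
  let y₁ := f.symm x₁ + ε₁
  (y₀, u₀, y₁, c₁ (y₀, u₀, y₁))

/-- A (possibly randomized) policy for one trajectory with controls bounded by `B`. The random seed
is drawn once, independently of the noise, and is available to all controls. -/
structure Policy (B : ℝ) where
  Seed : Type
  [seedSpace : MeasurableSpace Seed]
  seedLaw : Measure Seed
  [isProb : IsProbabilityMeasure seedLaw]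
  control₀ : Seed → ℝ → ℝ
  control₁ : Seed → ℝ × ℝ × ℝ → ℝ
  measurable_control₀ : Measurable (Function.uncurry control₀)
  measurable_control₁ : Measurable (Function.uncurry control₁)
  abs_control₀_le : ∀ s y, |control₀ s y| ≤ B
  abs_control₁_le : ∀ s o, |control₁ s o| ≤ B

attribute [instance] Policy.seedSpace Policy.isProb

/-- A learning algorithm that plays `m` trajectories with controls bounded by `B` and then outputs a
decoder. Its internal randomness is a seed of arbitrary law, independent of the noise. The controls
of trajectory number `j` (counted from `0`) depend measurably on the seed, on the records of the `j`
trajectories completed before, and on what has been observed in the current trajectory. The values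
of the controls for `j ≥ m` are never used. The decoder `y ↦ decoder s S y` depends
(jointly measurably) on the seed `s` and on all the records `S`. -/
structure Algorithm (m : ℕ) (B : ℝ) where
  Seed : Type
  [seedSpace : MeasurableSpace Seed]
  seedLaw : Measure Seed
  [isProb : IsProbabilityMeasure seedLaw]
  control₀ : (j : ℕ) → Seed × (Fin j → Record) → ℝ → ℝ
  control₁ : (j : ℕ) → Seed × (Fin j → Record) → ℝ × ℝ × ℝ → ℝ
  decoder : Seed × (Fin m → Record) → ℝ → ℝ
  measurable_control₀ : ∀ j, Measurable (Function.uncurry (control₀ j))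
  measurable_control₁ : ∀ j, Measurable (Function.uncurry (control₁ j))
  measurable_decoder : Measurable (Function.uncurry decoder)
  abs_control₀_le : ∀ j h y, |control₀ j h y| ≤ B
  abs_control₁_le : ∀ j h o, |control₁ j h o| ≤ B

attribute [instance] Algorithm.seedSpace Algorithm.isProb

/-- The records of the first `k` trajectories played by the algorithm with seed `s`, when `f` is the
true decoder and `ω i` is the noise in trajectory number `i`. -/
def transcript (sys : ScalarSystem) (f : ℝ ≃ ℝ) {m : ℕ} {B : ℝ} (A : Algorithm m B)
    (s : A.Seed) : (k : ℕ) → (Fin k → Noise) → (Fin k → Record)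
  | 0, _ => Fin.elim0
  | k + 1, ω =>
    let h := transcript sys f A s k (Fin.init ω)
    Fin.snoc (α := fun _ => Record) h
      (trajectory sys f (A.control₀ k (s, h)) (A.control₁ k (s, h)) (ω (Fin.last k)))

/-- The expected squared decoding error `E_A E_π (f̂_A(y_1) - f(y_1))²` when `f` is the true decoder:
`f̂_A` is learned from `m` trajectories with independent noises, and `y_1` is the observation at time
`1` in a fresh trajectory rolled in with `π`. It takes values in `[0, ∞]`. -/
noncomputable def decodingError (sys : ScalarSystem) (f : ℝ ≃ ℝ) {m : ℕ} {B B' : ℝ}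
    (A : Algorithm m B) (π : Policy B') : ℝ≥0∞ :=
  ∫⁻ s, ∫⁻ ω, ∫⁻ r, ∫⁻ ν,
    (let y₁ := (trajectory sys f (π.control₀ r) (π.control₁ r) ν).2.2.1
     ENNReal.ofReal ((A.decoder (s, transcript sys f A s m ω) y₁ - f y₁) ^ 2))
    ∂noiseLaw ∂π.seedLaw ∂(Measure.pi fun _ : Fin m => noiseLaw) ∂A.seedLaw

/-- A two-element class of invertible decoders that are `K`-Lipschitz and have derivative at least
`1` everywhere. -/
structure IsRegularPair (F : Finset (ℝ ≃ ℝ)) (K : ℝ) : Prop where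
  card_eq_two : F.card = 2
  abs_sub_le : ∀ f ∈ F, ∀ y y' : ℝ, |f y - f y'| ≤ K * |y - y'|
  differentiable : ∀ f ∈ F, Differentiable ℝ f
  one_le_deriv : ∀ f ∈ F, ∀ y : ℝ, 1 ≤ deriv f y

end NoisyDecoding

/-!
The system is `x_{t+1} = x_t / 2 + u_t + w_t` with `x_0 = 0`. Put `K = 66 √ℓ`, where `ℓ` is the
logarithm of the sample budget, and consider the two decoders `K y` and `K y + bend y`, where `bend`
is a differentiable function that vanishes on `(-∞, 1]`, is positive beyond `1` and has slope in
`[0, 1]`. The inverses of both decoders are `x ↦ x / K` on `(-∞, K]`.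

*The learner sees no difference.* Run an algorithm against both decoders with the same seed and the
same noise. Since `|u_0| ≤ 64 √ℓ`, the state `x_1` exceeds `K` only if `w_0 > 2 √ℓ`, so the two
transcripts coincide unless this happens in one of at most `exp ℓ` trajectories
(`transcript_eq_of_noise_le`). By the Gaussian tail bound that has probability at most
`exp ℓ * exp (-2 ℓ) ≤ 1/2`.

*The difference matters.* As `K` is so large, `f⁻¹(x_1) ∈ [-1, 1]` with constant probability, for
every roll-in policy. The observation noise has unit scale, so `y_1 = f⁻¹(x_1) + ε_1` has a density
bounded below by a constant on `[2, 3]` (`rollIn_lintegral_ge`), where the decoders differ by at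
least `bend 2`.

Hence a decoder produced from equal transcripts is far from one of the two decoders on `[2, 3]`
(`exists_learning_error_ge`), and the error is bounded below by an absolute constant. This is more
than the theorem needs, whose two parts are the cases `ℓ = log n` and `ℓ = ε ^ (-2/3)`.
-/

namespace NoisyDecoding

/-! ### The two decoders -/

/-- The slope of the perturbation: the piecewise linear function that is `0` up to `1` and `1` from
`2` on. -/
noncomputable def ramp (t : ℝ) : ℝ := max 0 (min 1 (t - 1))

/-- The perturbation that tells the two decoders apart: a differentiable function that vanishes up
to `1` and grows with slope at most `1` afterwards. -/
noncomputable def bend (y : ℝ) : ℝ := ∫ t in (1 : ℝ)..y, ramp t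

lemma continuous_ramp : Continuous ramp := by unfold ramp; fun_prop

lemma ramp_nonneg (t : ℝ) : 0 ≤ ramp t := le_max_left _ _

lemma ramp_le_one (t : ℝ) : ramp t ≤ 1 := max_le zero_le_one (min_le_left _ _)

lemma hasDerivAt_bend (y : ℝ) : HasDerivAt bend (ramp y) y :=
  continuous_ramp.integral_hasStrictDerivAt 1 y |>.hasDerivAt

lemma monotone_bend : Monotone bend :=
  monotone_of_deriv_nonneg (fun y => (hasDerivAt_bend y).differentiableAt)
    fun y => by rw [(hasDerivAt_bend y).deriv]; exact ramp_nonneg y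

lemma bend_eq_zero {y : ℝ} (hy : y ≤ 1) : bend y = 0 := by
  rw [bend, intervalIntegral.integral_congr (g := fun _ => (0 : ℝ))]
  · simp
  · intro t ht
    rw [Set.uIcc_of_ge hy] at ht
    exact max_eq_left ((min_le_right _ _).trans (by linarith [ht.2]))

lemma bend_two_pos : 0 < bend 2 := by
  refine intervalIntegral.intervalIntegral_pos_of_pos_on
    (continuous_ramp.intervalIntegrable _ _) (fun t ht => ?_) one_lt_two
  exact lt_max_of_lt_right (lt_min one_pos (by linarith [ht.1]))

lemma hasDerivAt_mul_add_bend (K θ y : ℝ) :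
    HasDerivAt (fun y => K * y + θ * bend y) (K + θ * ramp y) y := by
  have h := ((hasDerivAt_id y).const_mul K).add ((hasDerivAt_bend y).const_mul θ)
  rwa [mul_one] at h

lemma bijective_mul_add_bend {K θ : ℝ} (hK : 0 < K) (hθ : 0 ≤ θ) :
    Function.Bijective fun y => K * y + θ * bend y := by
  have hmono : Monotone fun y => θ * bend y := monotone_bend.const_mul hθ
  refine ⟨((strictMono_mul_left_of_pos hK).add_monotone hmono).injective, ?_⟩
  have hlin : Filter.Tendsto (fun y : ℝ => K * y) Filter.atTop Filter.atTop :=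
    Filter.tendsto_id.const_mul_atTop hK
  have hlin' : Filter.Tendsto (fun y : ℝ => K * y) Filter.atBot Filter.atBot :=
    Filter.tendsto_id.const_mul_atBot hK
  refine Continuous.surjective
    (continuous_iff_continuousAt.2 fun y => (hasDerivAt_mul_add_bend K θ y).continuousAt)
    (Filter.tendsto_atTop_mono' _ ?_ hlin) (Filter.tendsto_atBot_mono' _ ?_ hlin')
  · filter_upwards [Filter.eventually_ge_atTop 1] with y hy
    have := hmono hy
    simp only [bend_eq_zero le_rfl] at this
    linarith
  · filter_upwards [Filter.eventually_le_atBot 1] with y hy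
    simp [bend_eq_zero hy]

/-- The decoder `y ↦ K y + θ bend y`, used with `θ = 0` and `θ = 1`. -/
noncomputable def bentDecoder (K θ : ℝ) (hK : 0 < K) (hθ : 0 ≤ θ) : ℝ ≃ ℝ :=
  Equiv.ofBijective _ (bijective_mul_add_bend hK hθ)

section bentDecoder

variable {K θ : ℝ} (hK : 0 < K) (hθ : 0 ≤ θ)

lemma bentDecoder_apply (y : ℝ) : bentDecoder K θ hK hθ y = K * y + θ * bend y := rfl

lemma hasDerivAt_bentDecoder (y : ℝ) :
    HasDerivAt (bentDecoder K θ hK hθ) (K + θ * ramp y) y :=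
  hasDerivAt_mul_add_bend K θ y

lemma continuous_bentDecoder : Continuous (bentDecoder K θ hK hθ) :=
  continuous_iff_continuousAt.2 fun y => (hasDerivAt_bentDecoder hK hθ y).continuousAt

/-- Below the height `K` the inverse of the decoder does not depend on the perturbation. -/
lemma bentDecoder_symm_of_le {x : ℝ} (hx : x ≤ K) :
    (bentDecoder K θ hK hθ).symm x = x / K := by
  rw [Equiv.symm_apply_eq, bentDecoder_apply, bend_eq_zero ((div_le_one hK).2 hx)]
  field_simp
  simp

lemma measurable_bentDecoder_symm : Measurable (bentDecoder K θ hK hθ).symm := by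
  have hmono : StrictMono (bentDecoder K θ hK hθ) :=
    (strictMono_mul_left_of_pos hK).add_monotone (monotone_bend.const_mul hθ)
  refine Monotone.measurable fun x y hxy => ?_
  rw [← hmono.le_iff_le]
  simpa using hxy

lemma abs_bentDecoder_sub_le (hθ' : θ ≤ 1) (y y' : ℝ) :
    |bentDecoder K θ hK hθ y - bentDecoder K θ hK hθ y'| ≤ (K + 1) * |y - y'| := by
  refine Convex.norm_image_sub_le_of_norm_hasDerivWithin_le (s := Set.univ)
    (fun z _ => (hasDerivAt_bentDecoder hK hθ z).hasDerivWithinAt) (fun z _ => ?_)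
    convex_univ (Set.mem_univ _) (Set.mem_univ _)
  have h0 := mul_nonneg hθ (ramp_nonneg z)
  have h1 := mul_le_one₀ hθ' (ramp_nonneg z) (ramp_le_one z)
  rw [Real.norm_eq_abs, abs_of_nonneg (by linarith)]
  linarith

end bentDecoder

/-- The system `x_{t+1} = x_t / 2 + u_t + w_t` started at `0`. -/
noncomputable def halfSystem : ScalarSystem := ⟨1 / 2, 1, 0⟩

open Classical in
/-- The class consisting of a linear decoder and its perturbation. -/
noncomputable def decoderPair (K : ℝ) (hK : 0 < K) : Finset (ℝ ≃ ℝ) :=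
  {bentDecoder K 0 hK le_rfl, bentDecoder K 1 hK zero_le_one}

lemma mem_decoderPair {K : ℝ} (hK : 0 < K) (f : ℝ ≃ ℝ) : f ∈ decoderPair K hK ↔
    f = bentDecoder K 0 hK le_rfl ∨ f = bentDecoder K 1 hK zero_le_one := by
  simp [decoderPair]

lemma isRegularPair_decoderPair {K M : ℝ} (hK : 1 ≤ K) (hM : K + 1 ≤ M) :
    IsRegularPair (decoderPair K (one_pos.trans_le hK)) M := by
  have hmem : ∀ f ∈ decoderPair K (one_pos.trans_le hK), ∃ (θ : ℝ) (hθ : 0 ≤ θ), θ ≤ 1 ∧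
      f = bentDecoder K θ (one_pos.trans_le hK) hθ := by
    intro f hf
    rcases (mem_decoderPair _ f).1 hf with rfl | rfl
    · exact ⟨0, le_rfl, zero_le_one, rfl⟩
    · exact ⟨1, zero_le_one, le_rfl, rfl⟩
  refine ⟨?_, fun f hf y y' => ?_, fun f hf => ?_, fun f hf y => ?_⟩
  · classical
    refine Finset.card_pair fun h => ?_
    have := congrArg (fun f : ℝ ≃ ℝ => f 2) h
    simp only [bentDecoder_apply] at this
    linarith [bend_two_pos]
  · obtain ⟨θ, hθ, hθ', rfl⟩ := hmem f hf
    exact (abs_bentDecoder_sub_le _ hθ hθ' y y').trans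
      (mul_le_mul_of_nonneg_right hM (abs_nonneg _))
  · obtain ⟨θ, hθ, -, rfl⟩ := hmem f hf
    exact fun y => (hasDerivAt_bentDecoder _ hθ y).differentiableAt
  · obtain ⟨θ, hθ, -, rfl⟩ := hmem f hf
    rw [(hasDerivAt_bentDecoder _ hθ y).deriv]
    linarith [mul_nonneg hθ (ramp_nonneg y)]

/-! ### Measurability of transcripts -/

instance : IsProbabilityMeasure noiseLaw := by unfold noiseLaw; infer_instance

lemma measurable_trajectory {α : Type*} [MeasurableSpace α] (sys : ScalarSystem) {f : ℝ ≃ ℝ}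
    (hf : Measurable f.symm) {c₀ : α → ℝ → ℝ} {c₁ : α → ℝ × ℝ × ℝ → ℝ}
    (h₀ : Measurable (Function.uncurry c₀)) (h₁ : Measurable (Function.uncurry c₁)) :
    Measurable fun p : α × Noise => trajectory sys f (c₀ p.1) (c₁ p.1) p.2 := by
  have hy₀ : Measurable fun p : α × Noise => f.symm sys.x₀ + p.2.2.1 := by fun_prop
  have hu₀ : Measurable fun p : α × Noise => c₀ p.1 (f.symm sys.x₀ + p.2.2.1) :=
    h₀.comp (measurable_fst.prodMk hy₀)
  have hy₁ : Measurable fun p : α × Noise => f.symm (sys.a * sys.x₀ +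
      sys.b * c₀ p.1 (f.symm sys.x₀ + p.2.2.1) + p.2.1) + p.2.2.2 :=
    (hf.comp (((hu₀.const_mul _).const_add _).add (by fun_prop))).add (by fun_prop)
  have ho := hy₀.prodMk (hu₀.prodMk hy₁)
  exact hy₀.prodMk (hu₀.prodMk (hy₁.prodMk (h₁.comp (measurable_fst.prodMk ho))))

lemma measurable_transcript (sys : ScalarSystem) {f : ℝ ≃ ℝ} (hf : Measurable f.symm) {m : ℕ}
    {B : ℝ} (A : Algorithm m B) (k : ℕ) :
    Measurable fun p : A.Seed × (Fin k → Noise) => transcript sys f A p.1 k p.2 := by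
  induction k with
  | zero => exact measurable_pi_iff.2 fun i => i.elim0
  | succ k ih =>
    have hinit : Measurable fun p : A.Seed × (Fin (k + 1) → Noise) =>
        transcript sys f A p.1 k (Fin.init p.2) :=
      ih.comp (measurable_fst.prodMk (measurable_pi_iff.2 fun i =>
        (measurable_pi_apply i.castSucc).comp measurable_snd))
    have hlast := (measurable_trajectory sys hf (A.measurable_control₀ k)
      (A.measurable_control₁ k)).comp ((measurable_fst.prodMk hinit).prodMk
        ((measurable_pi_apply (Fin.last k)).comp measurable_snd))
    refine measurable_pi_iff.2 fun i => ?_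
    induction i using Fin.lastCases with
    | last => simpa only [transcript, Fin.snoc_last, Function.comp_def] using hlast
    | cast i =>
      simpa only [transcript, Fin.snoc_castSucc] using measurable_pi_iff.1 hinit i

/-! ### Indistinguishability -/

/-- Under coupled noise, the two decoders produce the same transcript as long as no state exceeds
`K`. -/
lemma transcript_eq_of_noise_le {K B θ θ' : ℝ} (hK : 0 < K) (hθ : 0 ≤ θ) (hθ' : 0 ≤ θ') {m : ℕ}
    (A : Algorithm m B) (s : A.Seed) (k : ℕ) (ω : Fin k → Noise) (hω : ∀ i, (ω i).1 ≤ K - B) :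
    transcript halfSystem (bentDecoder K θ hK hθ) A s k ω =
      transcript halfSystem (bentDecoder K θ' hK hθ') A s k ω := by
  induction k with
  | zero => rfl
  | succ k ih =>
    have hinit := ih (Fin.init ω) fun i => hω i.castSucc
    have hx₁ : ∀ h y, 1 / 2 * 0 + 1 * A.control₀ k h y + (ω (Fin.last k)).1 ≤ K := fun h y => by
      linarith [hω (Fin.last k), (abs_le.1 (A.abs_control₀_le k h y)).2]
    simp only [transcript, hinit]
    simp only [trajectory, halfSystem, bentDecoder_symm_of_le _ _ hK.le,
      bentDecoder_symm_of_le _ _ (hx₁ _ _)]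

lemma gaussianReal_Ioi_le {r : ℝ} (hr : 0 ≤ r) :
    gaussianReal 0 1 (Set.Ioi r) ≤ ENNReal.ofReal (Real.exp (-r ^ 2 / 2)) := by
  have hsub : HasSubgaussianMGF id 1 (gaussianReal 0 1) := by
    refine ⟨fun t => integrable_exp_mul_gaussianReal t, fun t => ?_⟩
    rw [mgf_id_gaussianReal]
    simp
  have := hsub.measure_ge_le hr
  simp only [NNReal.coe_one, mul_one, id] at this
  rw [← ofReal_measureReal]
  exact ENNReal.ofReal_le_ofReal ((measureReal_mono fun x (hx : r < x) => hx.le).trans this)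

/-- With at most `exp ℓ` trajectories, all the disturbances are at most `2 √ℓ` with probability at
least `1/2`. -/
lemma half_le_measure_noise_le {ℓ : ℝ} (hℓ : 1 ≤ ℓ) {m : ℕ} (hm : (m : ℝ) ≤ Real.exp ℓ) :
    1 / 2 ≤ (Measure.pi fun _ : Fin m => noiseLaw) {ω | ∀ i, (ω i).1 ≤ 2 * √ℓ} := by
  have hS : 0 ≤ 2 * √ℓ := by positivity
  have hmeas : MeasurableSet {ω : Fin m → Noise | ∀ i, (ω i).1 ≤ 2 * √ℓ} := by
    simp only [Set.ofPred_forall]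
    exact MeasurableSet.iInter fun i => measurableSet_le (by fun_prop) measurable_const
  have hone : ∀ i : Fin m, (Measure.pi fun _ : Fin m => noiseLaw) {ω | 2 * √ℓ < (ω i).1} ≤
      ENNReal.ofReal (Real.exp (-2 * ℓ)) := fun i => by
    have hpre := (measurePreserving_fst (μ := gaussianReal 0 1)
      (ν := (gaussianReal 0 1).prod (gaussianReal 0 1))).comp
      (measurePreserving_eval (fun _ : Fin m => noiseLaw) i)
    have := hpre.measure_preimage (measurableSet_Ioi (a := 2 * √ℓ)).nullMeasurableSet
    refine this.trans_le ((gaussianReal_Ioi_le hS).trans_eq ?_)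
    rw [mul_pow, Real.sq_sqrt (by linarith)]
    ring_nf
  have hexp : (2 : ℝ) ≤ Real.exp ℓ := by linarith [Real.add_one_le_exp ℓ]
  have hbad : (Measure.pi fun _ : Fin m => noiseLaw) {ω | ∀ i, (ω i).1 ≤ 2 * √ℓ}ᶜ ≤ 1 / 2 := by
    have hset : {ω : Fin m → Noise | ∀ i, (ω i).1 ≤ 2 * √ℓ}ᶜ = ⋃ i, {ω | 2 * √ℓ < (ω i).1} := by
      ext; simp
    calc _ ≤ ∑ i : Fin m, (Measure.pi fun _ : Fin m => noiseLaw) {ω | 2 * √ℓ < (ω i).1} := by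
          rw [hset]; exact measure_iUnion_fintype_le _ _
      _ ≤ ∑ _i : Fin m, ENNReal.ofReal (Real.exp (-2 * ℓ)) := Finset.sum_le_sum fun i _ => hone i
      _ = ENNReal.ofReal (m * Real.exp (-2 * ℓ)) := by
          rw [ENNReal.ofReal_mul (by positivity)]; simp
      _ ≤ ENNReal.ofReal (1 / 2) := by
          refine ENNReal.ofReal_le_ofReal ?_
          calc _ ≤ Real.exp ℓ * Real.exp (-2 * ℓ) := by gcongr
            _ = (Real.exp ℓ)⁻¹ := by rw [← Real.exp_add, ← Real.exp_neg]; ring_nf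
            _ ≤ 1 / 2 := by rw [one_div]; exact inv_anti₀ two_pos hexp
      _ = 1 / 2 := by rw [ENNReal.ofReal_div_of_pos two_pos]; simp
  rw [← compl_compl {ω : Fin m → Noise | ∀ i, (ω i).1 ≤ 2 * √ℓ}, prob_compl_eq_one_sub hmeas.compl]
  refine le_trans (le_of_eq ?_) (tsub_le_tsub_left hbad 1)
  simp

/-! ### Lower bound on the roll-in density -/

lemma gaussianPDFReal_four_le {x : ℝ} (h₁ : 1 ≤ x) (h₂ : x ≤ 4) :
    gaussianPDFReal 0 1 4 ≤ gaussianPDFReal 0 1 x := by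
  simp only [gaussianPDFReal]
  gcongr
  linarith

/-- A unit Gaussian centred in `[-1, 1]` has a density on `[2, 3]` that is at least the standard
Gaussian density at `4`. -/
lemma lintegral_gaussianReal_add_ge {G : ℝ → ℝ≥0∞} (hG : Measurable G) {z : ℝ} (hz : |z| ≤ 1) :
    ENNReal.ofReal (gaussianPDFReal 0 1 4) * ∫⁻ y in Set.Icc 2 3, G y ≤
      ∫⁻ e, G (z + e) ∂gaussianReal 0 1 := by
  rw [gaussianReal_of_var_ne_zero _ one_ne_zero, lintegral_withDensity_eq_lintegral_mul _
    (measurable_gaussianPDF 0 1) (by fun_prop), ← lintegral_const_mul _ hG]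
  calc _ ≤ ∫⁻ y in Set.Icc 2 3, gaussianPDF 0 1 (-z + y) * G (z + (-z + y)) :=
        setLIntegral_mono' measurableSet_Icc fun y hy => by
          have hz := abs_le.1 hz
          rw [add_neg_cancel_left]
          gcongr
          exact ENNReal.ofReal_le_ofReal
            (gaussianPDFReal_four_le (by linarith [hy.1]) (by linarith [hy.2]))
    _ ≤ ∫⁻ y, gaussianPDF 0 1 (-z + y) * G (z + (-z + y)) := setLIntegral_le_lintegral _ _
    _ = _ := lintegral_add_left_eq_self (fun e => gaussianPDF 0 1 e * G (z + e)) (-z)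

/-- The constant lower bound on the density of `y_1` on `[2, 3]`: the probability that the
disturbance lies in `[-2, 2]` times the standard Gaussian density at `4`. -/
noncomputable def rollInDensity : ℝ :=
  (gaussianReal 0 1).real (Set.Icc (-2) 2) * gaussianPDFReal 0 1 4

lemma rollInDensity_pos : 0 < rollInDensity := by
  refine mul_pos ?_ (gaussianPDFReal_pos _ _ _ one_ne_zero)
  refine ENNReal.toReal_pos (fun h => ?_) (measure_ne_top _ _)
  have := (gaussianReal_absolutelyContinuous' 0 (one_ne_zero (α := NNReal))) h
  norm_num [Real.volume_Icc] at this

/-- Whatever the roll-in control, the law of `y_1` dominates a multiple of Lebesgue measure on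
`[2, 3]`, because the decoder inverse compresses the typical range of `x_1` to `[-1, 1]`. -/
lemma rollIn_lintegral_ge {K B θ : ℝ} (hK : 0 < K) (hθ : 0 ≤ θ) (hB : B + 2 ≤ K)
    {c₀ : ℝ → ℝ} (hc₀ : Measurable c₀) (hc₀B : ∀ y, |c₀ y| ≤ B) {c₁ : ℝ × ℝ × ℝ → ℝ}
    (hc₁ : Measurable c₁) {G : ℝ → ℝ≥0∞} (hG : Measurable G) :
    ENNReal.ofReal rollInDensity * ∫⁻ y in Set.Icc 2 3, G y ≤
      ∫⁻ ν, G (trajectory halfSystem (bentDecoder K θ hK hθ) c₀ c₁ ν).2.2.1 ∂noiseLaw := by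
  have htraj : Measurable (trajectory halfSystem (bentDecoder K θ hK hθ) c₀ c₁) :=
    (measurable_trajectory (α := Unit) halfSystem (measurable_bentDecoder_symm hK hθ)
      (c₀ := fun _ => c₀) (c₁ := fun _ => c₁) (hc₀.comp measurable_snd)
      (hc₁.comp measurable_snd)).comp (measurable_const.prodMk measurable_id : Measurable
        fun ν : Noise => ((), ν))
  have hint : Measurable fun ν : Noise =>
      G (trajectory halfSystem (bentDecoder K θ hK hθ) c₀ c₁ ν).2.2.1 := by fun_prop
  rw [noiseLaw, lintegral_prod _ hint.aemeasurable]
  set κ := ENNReal.ofReal (gaussianPDFReal 0 1 4) * ∫⁻ y in Set.Icc 2 3, G y with hκ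
  have hw : ∀ w ∈ Set.Icc (-2 : ℝ) 2, κ ≤ ∫⁻ e, G (trajectory halfSystem
      (bentDecoder K θ hK hθ) c₀ c₁ (w, e)).2.2.1 ∂(gaussianReal 0 1).prod (gaussianReal 0 1) := by
    intro w hw
    have hint' := hint.comp (measurable_prodMk_left (x := w))
    simp only [Function.comp_def] at hint'
    rw [lintegral_prod _ hint'.aemeasurable]
    have he : ∀ e₀ : ℝ, κ ≤ ∫⁻ e₁, G (trajectory halfSystem
        (bentDecoder K θ hK hθ) c₀ c₁ (w, e₀, e₁)).2.2.1 ∂gaussianReal 0 1 := by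
      intro e₀
      refine lintegral_gaussianReal_add_ge hG (z := (bentDecoder K θ hK hθ).symm
        (1 / 2 * 0 + 1 * c₀ ((bentDecoder K θ hK hθ).symm 0 + e₀) + w)) ?_
      have hc := abs_le.1 (hc₀B ((bentDecoder K θ hK hθ).symm 0 + e₀))
      rw [bentDecoder_symm_of_le _ _ (by linarith [hw.2]), abs_div, abs_of_pos hK, div_le_one hK]
      exact abs_le.2 ⟨by linarith [hw.1], by linarith [hw.2]⟩
    calc κ = ∫⁻ _, κ ∂gaussianReal 0 1 := by simp
      _ ≤ _ := lintegral_mono he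
  calc _ = ∫⁻ _ in Set.Icc (-2 : ℝ) 2, κ ∂gaussianReal 0 1 := by
        rw [lintegral_const, Measure.restrict_apply_univ, rollInDensity,
          ENNReal.ofReal_mul measureReal_nonneg, ofReal_measureReal, hκ]
        ring
    _ ≤ ∫⁻ w in Set.Icc (-2 : ℝ) 2, _ ∂gaussianReal 0 1 :=
        setLIntegral_mono' measurableSet_Icc hw
    _ ≤ _ := setLIntegral_le_lintegral _ _

/-! ### The error of the learned decoder -/

/-- The expected squared `L²` distance on `[2, 3]` between the learned and the true decoder. -/
noncomputable def learningError (f : ℝ ≃ ℝ) {m : ℕ} {B : ℝ} (A : Algorithm m B) : ℝ≥0∞ :=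
  ∫⁻ s, ∫⁻ ω, ∫⁻ y in Set.Icc 2 3,
    ENNReal.ofReal ((A.decoder (s, transcript halfSystem f A s m ω) y - f y) ^ 2)
    ∂volume ∂(Measure.pi fun _ : Fin m => noiseLaw) ∂A.seedLaw

lemma measurable_decoding_loss {f : ℝ ≃ ℝ} (hf : Measurable f) (hf' : Measurable f.symm) {m : ℕ}
    {B : ℝ} (A : Algorithm m B) :
    Measurable fun q : (A.Seed × (Fin m → Noise)) × ℝ => ENNReal.ofReal
      ((A.decoder (q.1.1, transcript halfSystem f A q.1.1 m q.1.2) q.2 - f q.2) ^ 2) := by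
  have htr : Measurable fun q : (A.Seed × (Fin m → Noise)) × ℝ =>
      transcript halfSystem f A q.1.1 m q.1.2 :=
    (measurable_transcript halfSystem hf' A m).comp measurable_fst
  have hdec := A.measurable_decoder.comp
    (((measurable_fst.comp measurable_fst).prodMk htr).prodMk measurable_snd)
  exact ((hdec.sub (hf.comp measurable_snd)).pow_const 2).ennreal_ofReal

/-- The error under any roll-in policy dominates the policy-independent error on `[2, 3]`. -/
lemma learningError_le_decodingError {K B B' θ : ℝ} (hK : 0 < K) (hθ : 0 ≤ θ) (hB : B' + 2 ≤ K)
    {m : ℕ} (A : Algorithm m B) (π : Policy B') :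
    ENNReal.ofReal rollInDensity * learningError (bentDecoder K θ hK hθ) A ≤
      decodingError halfSystem (bentDecoder K θ hK hθ) A π := by
  have hloss := measurable_decoding_loss (continuous_bentDecoder hK hθ).measurable
    (measurable_bentDecoder_symm hK hθ) A
  have hin : Measurable fun p : A.Seed × (Fin m → Noise) => ∫⁻ y in Set.Icc 2 3, ENNReal.ofReal
      ((A.decoder (p.1, transcript halfSystem (bentDecoder K θ hK hθ) A p.1 m p.2) y -
        bentDecoder K θ hK hθ y) ^ 2) := hloss.lintegral_prod_right'
  unfold learningError decodingError
  rw [← lintegral_const_mul _ hin.lintegral_prod_right']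
  refine lintegral_mono fun s => ?_
  have hin' := hin.comp (measurable_prodMk_left (x := s))
  simp only [Function.comp_def] at hin'
  rw [← lintegral_const_mul _ hin']
  refine lintegral_mono fun ω => ?_
  have hr : ∀ r, ENNReal.ofReal rollInDensity * _ ≤ _ := fun r =>
    rollIn_lintegral_ge hK hθ hB (π.measurable_control₀.comp (measurable_prodMk_left (x := r)))
      (π.abs_control₀_le r) (π.measurable_control₁.comp (measurable_prodMk_left (x := r)))
      (hloss.comp (measurable_prodMk_left (x := (s, ω))))
  calc _ = ∫⁻ _, ENNReal.ofReal rollInDensity * _ ∂π.seedLaw := by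
        rw [lintegral_const, measure_univ, mul_one]
        rfl
    _ ≤ _ := lintegral_mono hr

/-- Two-point argument: as the two transcripts coincide with probability at least `1/2`, an
algorithm fails for one of the two decoders. -/
lemma exists_learning_error_ge {ℓ K B : ℝ} (hK : 0 < K) (hℓ : 1 ≤ ℓ) (hB : B + 2 * √ℓ ≤ K) {m : ℕ}
    (hm : (m : ℝ) ≤ Real.exp ℓ) (A : Algorithm m B) :
    ENNReal.ofReal (bend 2 ^ 2 / 8) ≤ learningError (bentDecoder K 0 hK le_rfl) A ∨
      ENNReal.ofReal (bend 2 ^ 2 / 8) ≤ learningError (bentDecoder K 1 hK zero_le_one) A := by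
  set f := bentDecoder K 0 hK le_rfl with hf
  set g := bentDecoder K 1 hK zero_le_one with hg
  have hlossf := measurable_decoding_loss (f := f) (continuous_bentDecoder hK _).measurable
    (measurable_bentDecoder_symm hK _) A
  have hinf : Measurable fun p : A.Seed × (Fin m → Noise) => ∫⁻ y in Set.Icc 2 3, ENNReal.ofReal
      ((A.decoder (p.1, transcript halfSystem f A p.1 m p.2) y - f y) ^ 2) :=
    hlossf.lintegral_prod_right'
  -- By the parallelogram inequality, equal transcripts cost at least `(f - g)² / 2` in total.
  have hsum : ∀ s ω, (∀ i, (ω i).1 ≤ 2 * √ℓ) → ENNReal.ofReal (bend 2 ^ 2 / 2) ≤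
      (∫⁻ y in Set.Icc 2 3, ENNReal.ofReal
        ((A.decoder (s, transcript halfSystem f A s m ω) y - f y) ^ 2)) +
      ∫⁻ y in Set.Icc 2 3, ENNReal.ofReal
        ((A.decoder (s, transcript halfSystem g A s m ω) y - g y) ^ 2) := by
    intro s ω hω
    rw [transcript_eq_of_noise_le hK zero_le_one le_rfl A s m ω
      fun i => (hω i).trans (by linarith), ← hf]
    have hlossf' := hlossf.comp (measurable_prodMk_left (x := (s, ω)))
    simp only [Function.comp_def] at hlossf'
    rw [← lintegral_add_left hlossf']
    calc _ = ∫⁻ _ in Set.Icc (2 : ℝ) 3, ENNReal.ofReal (bend 2 ^ 2 / 2) := by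
          rw [lintegral_const, Measure.restrict_apply_univ, Real.volume_Icc]; norm_num
      _ ≤ _ := setLIntegral_mono' measurableSet_Icc fun y hy => by
          rw [← ENNReal.ofReal_add (sq_nonneg _) (sq_nonneg _)]
          refine ENNReal.ofReal_le_ofReal ?_
          simp only [hf, hg, bentDecoder_apply]
          have hb := pow_le_pow_left₀ bend_two_pos.le (monotone_bend hy.1) 2
          generalize A.decoder _ y = d
          nlinarith [sq_nonneg (2 * (d - K * y) - bend y)]
  have htotal : ENNReal.ofReal (bend 2 ^ 2 / 4) ≤ learningError f A + learningError g A := by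
    unfold learningError
    rw [← lintegral_add_left hinf.lintegral_prod_right']
    calc _ = ∫⁻ _, ENNReal.ofReal (bend 2 ^ 2 / 4) ∂A.seedLaw := by simp
      _ ≤ _ := lintegral_mono fun s => ?_
    have hinf' := hinf.comp (measurable_prodMk_left (x := s))
    simp only [Function.comp_def] at hinf'
    rw [← lintegral_add_left hinf']
    calc _ = ENNReal.ofReal (bend 2 ^ 2 / 2) * (1 / 2) := by
          rw [show bend 2 ^ 2 / 4 = bend 2 ^ 2 / 2 * (1 / 2) by ring,
            ENNReal.ofReal_mul (by positivity), ENNReal.ofReal_div_of_pos two_pos]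
          simp
      _ ≤ ENNReal.ofReal (bend 2 ^ 2 / 2) * (Measure.pi fun _ : Fin m => noiseLaw)
          {ω | ∀ i, (ω i).1 ≤ 2 * √ℓ} := by gcongr; exact half_le_measure_noise_le hℓ hm
      _ = ∫⁻ _ in {ω | ∀ i, (ω i).1 ≤ 2 * √ℓ}, ENNReal.ofReal (bend 2 ^ 2 / 2)
          ∂(Measure.pi fun _ : Fin m => noiseLaw) := by
          rw [lintegral_const, Measure.restrict_apply_univ]
      _ ≤ ∫⁻ ω in {ω | ∀ i, (ω i).1 ≤ 2 * √ℓ}, _ ∂(Measure.pi fun _ : Fin m => noiseLaw) :=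
          setLIntegral_mono' ?_ (hsum s)
      _ ≤ _ := setLIntegral_le_lintegral _ _
    simp only [Set.ofPred_forall]
    exact MeasurableSet.iInter fun i => measurableSet_le (by fun_prop) measurable_const
  by_contra! hlt
  refine (ENNReal.add_lt_add hlt.1 hlt.2).not_ge (htotal.trans' (le_of_eq ?_))
  rw [← ENNReal.ofReal_add (by positivity) (by positivity)]
  ring_nf

/-- The lower bound for a sample budget `exp ℓ` with an absolute constant in place of a function of
`ℓ`. -/
lemma exists_forall_const_le_decodingError {ℓ : ℝ} (hℓ : 1 ≤ ℓ) :
    ∃ (sys : ScalarSystem) (F : Finset (ℝ ≃ ℝ)), |sys.a| < 1 ∧ sys.b ≠ 0 ∧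
      IsRegularPair F (67 * √ℓ) ∧
      ∀ m : ℕ, (m : ℝ) ≤ Real.exp ℓ → ∀ A : Algorithm m (64 * √ℓ),
      ∃ f ∈ F, ∀ π : Policy (64 * √ℓ),
        ENNReal.ofReal (rollInDensity * (bend 2 ^ 2 / 8)) ≤ decodingError sys f A π := by
  have hS : 1 ≤ √ℓ := Real.one_le_sqrt.2 hℓ
  have hK : 1 ≤ 66 * √ℓ := by linarith
  refine ⟨halfSystem, decoderPair (66 * √ℓ) (one_pos.trans_le hK), ?_, one_ne_zero,
    isRegularPair_decoderPair hK (by linarith), fun m hm A => ?_⟩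
  · norm_num [halfSystem, abs_of_pos]
  rw [ENNReal.ofReal_mul rollInDensity_pos.le]
  rcases exists_learning_error_ge (one_pos.trans_le hK) hℓ (by linarith) hm A with h | h
  · exact ⟨_, (mem_decoderPair _ _).2 (.inl rfl), fun π => (mul_le_mul_right h _).trans
      (learningError_le_decodingError _ _ (by linarith) A π)⟩
  · exact ⟨_, (mem_decoderPair _ _).2 (.inr rfl), fun π =>
      (mul_le_mul_right h _).trans (learningError_le_decodingError _ _ (by linarith) A π)⟩

end NoisyDecoding

theorem mainTheorem2 :
    (∃ c L : ℝ, ∃ n₀ : ℕ, 0 < c ∧ 0 < L ∧ ∀ n : ℕ, n₀ ≤ n →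
      ∃ (sys : NoisyDecoding.ScalarSystem) (F : Finset (ℝ ≃ ℝ)),
        |sys.a| < 1 ∧ sys.b ≠ 0 ∧
        NoisyDecoding.IsRegularPair F (L * Real.sqrt (Real.log n)) ∧
        ∀ m : ℕ, m ≤ n →
        ∀ A : NoisyDecoding.Algorithm m (64 * Real.sqrt (Real.log n)),
        ∃ f ∈ F, ∀ π : NoisyDecoding.Policy (64 * Real.sqrt (Real.log n)),
          ENNReal.ofReal (c / (Real.log n) ^ (3 / 2 : ℝ)) ≤
            NoisyDecoding.decodingError sys f A π) ∧
    (∃ c L ε₀ : ℝ, 0 < c ∧ 0 < L ∧ 0 < ε₀ ∧ ∀ ε : ℝ, 0 < ε → ε < ε₀ →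
      ∃ (sys : NoisyDecoding.ScalarSystem) (F : Finset (ℝ ≃ ℝ)),
        |sys.a| < 1 ∧ sys.b ≠ 0 ∧
        NoisyDecoding.IsRegularPair F (L * ε ^ (-(1 / 3) : ℝ)) ∧
        ∀ m : ℕ, (m : ℝ) ≤ Real.exp (c * ε ^ (-(2 / 3) : ℝ)) →
        ∀ A : NoisyDecoding.Algorithm m (64 * Real.sqrt (c * ε ^ (-(2 / 3) : ℝ))),
        ∃ f ∈ F, ∀ π : NoisyDecoding.Policy (64 * Real.sqrt (c * ε ^ (-(2 / 3) : ℝ))),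
          ENNReal.ofReal ε < NoisyDecoding.decodingError sys f A π) := by
  set c₀ := NoisyDecoding.rollInDensity * (NoisyDecoding.bend 2 ^ 2 / 8)
  have hc₀pos : 0 < c₀ := mul_pos NoisyDecoding.rollInDensity_pos
    (div_pos (pow_pos NoisyDecoding.bend_two_pos 2) (by norm_num))
  refine ⟨⟨c₀, 67, 3, hc₀pos, by norm_num, fun n hn => ?_⟩,
    1, 67, min 1 c₀, one_pos, by norm_num, lt_min one_pos hc₀pos, fun ε hε hε' => ?_⟩
  · have hn' : (3 : ℝ) ≤ n := by exact_mod_cast hn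
    have hlog : 1 ≤ Real.log n := by
      rw [Real.le_log_iff_exp_le (by linarith)]
      linarith [Real.exp_one_lt_d9]
    obtain ⟨sys, F, ha, hb, hF, h⟩ := NoisyDecoding.exists_forall_const_le_decodingError hlog
    refine ⟨sys, F, ha, hb, hF, fun m hm A => ?_⟩
    obtain ⟨f, hf, hπ⟩ := h m (by rw [Real.exp_log (by linarith)]; exact_mod_cast hm) A
    exact ⟨f, hf, fun π => (ENNReal.ofReal_le_ofReal (div_le_self hc₀pos.le
      (Real.one_le_rpow hlog (by norm_num)))).trans (hπ π)⟩
  · have hℓ : 1 ≤ ε ^ (-(2 / 3) : ℝ) := Real.one_le_rpow_of_pos_of_le_one_of_nonpos hε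
      (hε'.le.trans (min_le_left _ _)) (by norm_num)
    have hsqrt : √(ε ^ (-(2 / 3) : ℝ)) = ε ^ (-(1 / 3) : ℝ) := by
      rw [Real.sqrt_eq_rpow, ← Real.rpow_mul hε.le]
      norm_num
    rw [one_mul]
    obtain ⟨sys, F, ha, hb, hF, h⟩ := NoisyDecoding.exists_forall_const_le_decodingError hℓ
    refine ⟨sys, F, ha, hb, by rwa [hsqrt] at hF, fun m hm A => ?_⟩
    obtain ⟨f, hf, hπ⟩ := h m hm A
    exact ⟨f, hf, fun π => ((ENNReal.ofReal_lt_ofReal_iff hc₀pos).2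
      (hε'.trans_le (min_le_right _ _))).trans_le (hπ π)⟩
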